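/- **Model.** A read-only cloud stores an array $X\in\{0,1\}^n$; $k\le n$ machines $M_1,\dots,M_k$ form a complete synchronous network. In each round a machine first sends a batch of queries to the cloud (query $i$ returns $x_i$), and then sends at most one message of $\lceil\log_2 n\rceil$ bits to each other machine. Algorithms are deterministic; an all-knowing adversary chooses $X$ and a set of at most $\beta k$ Byzantine machines, which send arbitrary messages, where $0<\beta<1$ is known and $\beta k$ is an integer. Put $\gamma=1-\beta$. $\mathcal Q$ is the maximum number of queries made by an honest machine, $\mathcal M$ the total number of messages sent by honest machines, and $\mathcal T$ the number of rounds until all honest machines have terminated. **Problem.** In Explicit Disjunction with known density parameter $0<\delta\le 1$, the input has either no ones or at least $\delta n$ ones (in particular, exactly $\delta n$ ones is allowed). Every honest machine must output $0$ if $X=0$, and an index $i$ with $x_i=1$ otherwise. Put $\bar\delta=\max(1/n,\delta)$. **Expanders.** A bipartite graph $G$ with left side $[n]$ and right side $\{M_1,\dots,M_k\}$ is an $(n,k,\beta,\delta,s)$-Guaranteed Large Set Expander (GLSE) with right degree at most $D$ if every right vertex has degree at most $D$ and, for all $S\subseteq[n]$ with $|S|\ge\delta n$ and all sets $T$ of machines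 with $|T|\le\beta k$, some $u\in S$ satisfies $|\Gamma(u)\setminus T|\ge s$. **Algorithm GLSE_Explicit_Disjunct** (with graph $G$ and threshold $s$; code for $M_l$). Phase 1: query all $j\in\Gamma(M_l)$; send every $j$ with $x_j=1$ to all machines, one index per round during $n$ rounds. Phase 2: start with $B=\emptyset$. While some $j$ was sent by at least $s$ machines outside $B$ (a machine counts itself as a sender of the ones it found), take the least such $j$ and query it; if $x_j=1$ return $j$, else add all machines that sent $j$ to $B$. When no such $j$ is left, return $0$. **Theorem.** Let $s=k\sqrt{\beta\gamma/n}$ and $$q(n,k,\beta,\delta)=\frac nk\cdot\frac{\log n}{\gamma^2}+\frac1{\bar\delta}\cdot\frac{\log k}{\gamma^2}+\sqrt{\frac n\gamma}.$$ There are absolute constants $C_0,C>0$ such that for all integers $1\le k\le n$ and all $\beta\in(0,1)$ with $\beta k$ an integer and $\delta\in(0,1]$: an $(n,k,\beta,\delta,s)$-GLSE with right degree at most $C_0\,q(n,k,\beta,\delta)$ exists, and with every such GLSE the algorithm GLSE_Explicit_Disjunct solves Explicit Disjunction against at most $\beta k$ Byzantine machines with $$\mathcal Q\le C\,q(n,k,\beta,\delta),\qquad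 \mathcal T\le C\,n,\qquad \mathcal M\le C\,nk^2 .$$ In particular, for every fixed $\beta<1$, $\mathcal Q=O\!\left(\frac{n\log n}{k}+\frac{\log k}{\bar\delta}+\sqrt n\right)$, $\mathcal T=O(n)$ and $\mathcal M=O(nk^2)$. -/

import Mathlib

/-! ### The congested clique with cloud assistance, deterministic setting -/

/-- A deterministic algorithm for `k` machines with read-only access to an `n`-bit cloud array and
messages of `w` bits. In every round a machine first sends a batch of queries to the cloud and
receives the answers (`query`, `learn`), then sends at most one `w`-bit message to each other
machine and receives the messages of the other machines (`send`, `receive`). All local functions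
may depend on the ID of the machine. A machine terminates as soon as `output` is `some`. -/
structure CCAAlgorithm (n k w : ℕ) (Out : Type) where
  State : Type
  init : Fin k → State
  query : Fin k → State → Finset (Fin n)
  learn : Fin k → State → (Fin n → Option Bool) → State
  send : Fin k → State → Fin k → Option (BitVec w)
  receive : Fin k → State → (Fin k → Option (BitVec w)) → State
  output : State → Option Out

/-- The choices of the adversary: the input array, the set of Byzantine machines, and the message
(if any) that Byzantine machine `i` sends to machine `j` in round `r`, as `msg r i j`. As the
algorithm is deterministic, an arbitrary table of messages covers every adaptive strategy of an
all-knowing adversary. -/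
structure Scenario (n k w : ℕ) where
  input : Fin n → Bool
  byz : Finset (Fin k)
  msg : ℕ → Fin k → Fin k → Option (BitVec w)

namespace CCAAlgorithm

variable {n k w : ℕ} {Out : Type}

/-- The answers of the cloud with array `X` to the set `q` of queries. -/
def cloudAnswers (X : Fin n → Bool) (q : Finset (Fin n)) : Fin n → Option Bool :=
  fun j => if j ∈ q then some (X j) else none

/-- The queries of machine `i` in a round that it begins in state `st`; none after termination. -/
def queriesOf (A : CCAAlgorithm n k w Out) (i : Fin k) (st : A.State) : Finset (Fin n) :=
  if (A.output st).isSome then ∅ else A.query i st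

/-- The state of machine `i` after the query sub-round. -/
def afterQuery (A : CCAAlgorithm n k w Out) (X : Fin n → Bool) (i : Fin k) (st : A.State) :
    A.State :=
  if (A.output st).isSome then st else A.learn i st (cloudAnswers X (A.query i st))

/-- The message sent from `i` to `j` in round `r`, when `mid` gives the states of the machines after
the query sub-round of round `r`. Nothing is sent to oneself, nor by a terminated honest machine. -/
def messageSent (A : CCAAlgorithm n k w Out) (E : Scenario n k w) (r : ℕ) (mid : Fin k → A.State)
    (i j : Fin k) : Option (BitVec w) :=
  if i = j then none
  else if i ∈ E.byz then E.msg r i j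
  else if (A.output (mid i)).isSome then none
  else A.send i (mid i) j

/-- The states at the beginning of round `r` (rounds are numbered from `0`). The entries of the
Byzantine machines have no influence on the honest ones. -/
def stateAt (A : CCAAlgorithm n k w Out) (E : Scenario n k w) : ℕ → Fin k → A.State
  | 0 => A.init
  | r + 1 => fun i =>
      let mid : Fin k → A.State := fun t => A.afterQuery E.input t (stateAt A E r t)
      if (A.output (mid i)).isSome then mid i
      else A.receive i (mid i) (fun t => A.messageSent E r mid t i)

/-- The number of queries made by machine `i` in the first `R` rounds. -/
def queryCount (A : CCAAlgorithm n k w Out) (E : Scenario n k w) (i : Fin k) (R : ℕ) : ℕ :=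
  ∑ r ∈ Finset.range R, (A.queriesOf i (A.stateAt E r i)).card

/-- The number of messages sent by all honest machines in the first `R` rounds. -/
def messageCount (A : CCAAlgorithm n k w Out) (E : Scenario n k w) (R : ℕ) : ℕ :=
  ∑ r ∈ Finset.range R, ∑ i ∈ E.byzᶜ,
    (Finset.univ.filter fun j =>
      (A.messageSent E r (fun t => A.afterQuery E.input t (A.stateAt E r t)) i j).isSome).card

/-- In all scenarios of `F`, every honest machine terminates with a correct output. -/
def Solves (A : CCAAlgorithm n k w Out) (F : Set (Scenario n k w))
    (Correct : (Fin n → Bool) → Out → Prop) : Prop :=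
  ∀ E ∈ F, ∀ i, i ∉ E.byz → ∃ r o, A.output (A.stateAt E r i) = some o ∧ Correct E.input o

/-- In all scenarios of `F`, every honest machine makes at most `q` queries in total. -/
def QueryComplexityLE (A : CCAAlgorithm n k w Out) (F : Set (Scenario n k w)) (q : ℝ) : Prop :=
  ∀ E ∈ F, ∀ i, i ∉ E.byz → ∀ R, (A.queryCount E i R : ℝ) ≤ q

/-- In all scenarios of `F`, every honest machine has terminated after at most `t` rounds. -/
def RoundComplexityLE (A : CCAAlgorithm n k w Out) (F : Set (Scenario n k w)) (t : ℝ) : Prop :=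
  ∀ E ∈ F, ∃ R : ℕ, (R : ℝ) ≤ t ∧ ∀ i, i ∉ E.byz → (A.output (A.stateAt E R i)).isSome

/-- In all scenarios of `F`, the honest machines together send at most `m` messages in total. -/
def MessageComplexityLE (A : CCAAlgorithm n k w Out) (F : Set (Scenario n k w)) (m : ℝ) : Prop :=
  ∀ E ∈ F, ∀ R, (A.messageCount E R : ℝ) ≤ m

end CCAAlgorithm

/-! ### The Explicit Disjunction problem -/

/-- The number of ones of the input. -/
def onesCount {n : ℕ} (X : Fin n → Bool) : ℕ := (Finset.univ.filter fun j => X j = true).card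

/-- Output `some j` stands for the index `j` of a one, output `none` for the answer `0`. -/
def ExplicitDisjunctionCorrect {n : ℕ} (X : Fin n → Bool) : Option (Fin n) → Prop
  | some j => X j = true
  | none => ∀ j, X j = false

/-- The scenarios of Explicit Disjunction with density parameter `δ` against at most `β k` Byzantine
machines: the input has no ones or at least `δ n` ones (in particular, inputs with exactly
`δ n` ones are allowed). -/
def explicitDisjunctionScenarios (n k w : ℕ) (β δ : ℝ) : Set (Scenario n k w) :=
  {E | (E.byz.card : ℝ) ≤ β * k ∧
    (onesCount E.input = 0 ∨ δ * n ≤ (onesCount E.input : ℝ))}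

/-! ### Guaranteed large set expanders -/

/-- A bipartite graph with left side `Fin n` (bits) and right side `Fin k` (machines), given by the
neighbourhoods of the left vertices. -/
abbrev BipGraph (n k : ℕ) := Fin n → Finset (Fin k)

/-- The neighbourhood of a right vertex. -/
def BipGraph.nbrRight {n k : ℕ} (G : BipGraph n k) (l : Fin k) : Finset (Fin n) :=
  Finset.univ.filter fun j => l ∈ G j

/-- `(n, k, β, δ, s)`-guaranteed large set expander all of whose right degrees are at most `D`. -/
structure IsGLSE {n k : ℕ} (G : BipGraph n k) (β δ s D : ℝ) : Prop where
  degree_le : ∀ l : Fin k, ((G.nbrRight l).card : ℝ) ≤ D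
  expands : ∀ (S : Finset (Fin n)) (T : Finset (Fin k)), δ * n ≤ (S.card : ℝ) →
    (T.card : ℝ) ≤ β * k → ∃ u ∈ S, s ≤ ((G u \ T).card : ℝ)

/-! ### The algorithm -/

/-- Local state of a machine. -/
structure GLSEState (n k : ℕ) where
  /-- number of completed rounds -/
  round : ℕ
  /-- indices of ones that still have to be announced -/
  outbox : List (Fin n)
  /-- for each machine, the indices it has announced -/
  heard : Fin k → Finset (Fin n)
  /-- machines marked as Byzantine -/
  blacklist : Finset (Fin k)
  /-- the returned value, once there is one -/
  result : Option (Option (Fin n))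

/-- The least index announced by at least `s` machines that are not blacklisted, if there is one. -/
noncomputable def GLSEState.candidate {n k : ℕ} (s : ℝ) (st : GLSEState n k) : Option (Fin n) :=
  (List.finRange n).find? fun j => decide
    (s ≤ ((Finset.univ.filter fun t => t ∉ st.blacklist ∧ j ∈ st.heard t).card : ℝ))

/-- An index as a message of `⌈log₂ n⌉` bits. -/
def encodeIndex {n : ℕ} (j : Fin n) : BitVec (Nat.clog 2 n) := BitVec.ofNat _ j.val

/-- The set consisting of the index contained in a message; empty if there is no message or if it
is not the encoding of an index. -/
def decodeIndex {n : ℕ} : Option (BitVec (Nat.clog 2 n)) → Finset (Fin n)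
  | none => ∅
  | some v => if h : v.toNat < n then {⟨v.toNat, h⟩} else ∅

/-- The algorithm `GLSE_Explicit_Disjunct` run with the graph `G` and the threshold `s`.

Phase 1 (rounds `0, …, n - 1`): in round `0`, machine `l` queries its neighbourhood in `G`; it then
announces the ones it has found to all machines, one index per round.

Phase 2 (from round `n` on): as long as some index `j` was announced by at least `s` machines that are
not blacklisted, the machine queries `j` (one query per round), returns `j` if the bit is one, and
otherwise blacklists all machines that announced `j`. If there is no such `j`, it returns `0`. -/
noncomputable def glseExplicitDisjunct {n k : ℕ} (G : BipGraph n k) (s : ℝ) :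
    CCAAlgorithm n k (Nat.clog 2 n) (Option (Fin n)) where
  State := GLSEState n k
  init := fun _ =>
    { round := 0, outbox := [], heard := fun _ => ∅, blacklist := ∅, result := none }
  query := fun l st =>
    if st.round = 0 then G.nbrRight l
    else if st.round < n then ∅
    else match st.candidate s with
      | none => ∅
      | some j => {j}
  learn := fun l st ans =>
    if st.round = 0 then
      let found : Finset (Fin n) := Finset.univ.filter fun j => ans j = some true
      { st with outbox := found.sort, heard := Function.update st.heard l found }
    else if st.round < n then st
    else match st.candidate s with
      | none => { st with result := some none }
      | some j =>
          if ans j = some true then { st with result := some (some j) }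
          else { st with
            blacklist := st.blacklist ∪ Finset.univ.filter fun t => j ∈ st.heard t }
  send := fun _ st _ => if st.round < n then st.outbox.head?.map encodeIndex else none
  receive := fun _ st msgs =>
    { st with
      round := st.round + 1
      outbox := st.outbox.tail
      heard := if st.round < n then fun t => st.heard t ∪ decodeIndex (msgs t) else st.heard }
  output := fun st => st.result

/-- The threshold `s = k √(β γ / n)` with `γ = 1 - β`. -/
noncomputable def glseThreshold (n k : ℕ) (β : ℝ) : ℝ := k * √(β * (1 - β) / n)

/-- `(n / k) (log n / γ²) + (1 / δ̄) (log k / γ²) + √(n / γ)` with `γ = 1 - β` and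
`δ̄ = max (1 / n) δ`. -/
noncomputable def glseQueryRate (n k : ℕ) (β δ : ℝ) : ℝ :=
  (n / k : ℝ) * (Real.log n / (1 - β) ^ 2)
    + 1 / max (1 / (n : ℝ)) δ * (Real.log k / (1 - β) ^ 2)
    + √(n / (1 - β))

/-! Two independent facts are combined: sparse expanders exist, and on any such expander Byzantine
machines can cause few failed verifications.

Existence is probabilistic. Cut the bits into blocks of length `r` and let every machine choose one
uniform position in each block, independently. Degrees are then bounded by the number of blocks with
certainty, and the edges between `S` and `U` are counted by independent indicators indexed by
machine and block. If every vertex of `S` had fewer than `s` neighbours in `U`, there would be at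
most `s * |S|` edges; the exponential moment in `sum_half_pow_edges_le` and a union bound over all
pairs with `|S| = m = ⌈δ n⌉` and `|U| = a = γ k` rule this out. The block length is chosen to make
the union bound succeed; when no positive length would do, the complete graph is sparse enough.

For the algorithm, each index that fails verification was announced only by Byzantine machines, at
least `s` of them not yet blacklisted. Hence the number `f` of failures satisfies `f * s ≤ β k`, so
`f ≤ √(n / γ)`, and `f ≤ k` because `s > 0`. Honest machines never get blacklisted, so for a nonzero
input the expander supplies a one announced by `s` admissible machines, and `0` cannot be returned
by mistake. The invariant `VerifyInv` and the step `glse_verify_succ` carry this argument. -/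

/-! ### Random block graphs and the union bound -/

/-- The graph in which the left side is cut into blocks of length `r` and machine `l` is joined to
position `g (l, B)` of every block `B`. -/
def blockGraph {n k r d : ℕ} (g : Fin k × Fin d → Fin r) : BipGraph n k :=
  fun u => Finset.univ.filter fun l => ∃ B : Fin d, u.val = B.val * r + (g (l, B)).val

/-- One position per block gives a bound for every choice `g`, so degrees need no concentration
argument. -/
theorem card_nbrRight_blockGraph_le {n k r d : ℕ} (g : Fin k × Fin d → Fin r) (l : Fin k) :
    ((blockGraph g : BipGraph n k).nbrRight l).card ≤ d := by
  classical
  have h : ∀ u ∈ (blockGraph g : BipGraph n k).nbrRight l,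
      ∃ B : Fin d, u.val = B.val * r + (g (l, B)).val := by
    intro u hu
    simpa [BipGraph.nbrRight, blockGraph] using hu
  have hsub : ((blockGraph g : BipGraph n k).nbrRight l).image Fin.val ⊆
      Finset.univ.image fun B : Fin d => B.val * r + (g (l, B)).val := by
    intro x hx
    obtain ⟨u, hu, rfl⟩ := Finset.mem_image.mp hx
    obtain ⟨B, hB⟩ := h u hu
    exact Finset.mem_image.mpr ⟨B, Finset.mem_univ B, hB.symm⟩
  have := (Finset.card_le_card hsub).trans Finset.card_image_le
  rwa [Finset.card_image_of_injective _ Fin.val_injective, Finset.card_univ,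
    Fintype.card_fin] at this

/-- The number of edges between `S` and `U` in `blockGraph g`, counted by machine and block. -/
theorem sum_card_inter_blockGraph {n k r d : ℕ} (g : Fin k × Fin d → Fin r)
    (S : Finset (Fin n)) (U : Finset (Fin k)) (hd : ∀ u : Fin n, u.val / r < d) :
    ∑ u ∈ S, ((blockGraph g : BipGraph n k) u ∩ U).card =
      ((Finset.univ : Finset (Fin k × Fin d)).filter fun x =>
        x.1 ∈ U ∧ ∃ u ∈ S, u.val = x.2.val * r + (g x).val).card := by
  classical
  rw [← Finset.card_sigma]
  -- A machine picks a single position per block, so an edge is determined by its machine and the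
  -- block of its bit.
  refine Finset.card_bij (fun x _ => (x.2, ⟨x.1.val / r, hd x.1⟩)) ?_ ?_ ?_
  · rintro ⟨u, l⟩ h
    simp only [blockGraph, Finset.mem_sigma, Finset.mem_inter, Finset.mem_filter,
      Finset.mem_univ, true_and] at h ⊢
    obtain ⟨hu, ⟨B, hB⟩, hl⟩ := h
    refine ⟨hl, u, hu, ?_⟩
    have hr : 0 < r := (g (l, B)).pos
    have hq : u.val / r = B.val := by
      rw [hB, Nat.mul_comm, Nat.mul_add_div hr, Nat.div_eq_of_lt (g (l, B)).isLt, Nat.add_zero]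
    have : (⟨u.val / r, hd u⟩ : Fin d) = B := Fin.ext hq
    rw [this, hq]; exact hB
  · rintro ⟨u, l⟩ h ⟨v, l'⟩ h' heq
    simp only [blockGraph, Finset.mem_sigma, Finset.mem_inter, Finset.mem_filter,
      Finset.mem_univ, true_and] at h h'
    obtain ⟨hu, ⟨B, hB⟩, hl⟩ := h
    obtain ⟨hv, ⟨B', hB'⟩, hl'⟩ := h'
    simp only [Prod.mk.injEq, Fin.mk.injEq] at heq
    obtain ⟨rfl, hdiv⟩ := heq
    have hr : 0 < r := (g (l, B)).pos
    have hq : u.val / r = B.val := by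
      rw [hB, Nat.mul_comm, Nat.mul_add_div hr, Nat.div_eq_of_lt (g (l, B)).isLt, Nat.add_zero]
    have hq' : v.val / r = B'.val := by
      rw [hB', Nat.mul_comm, Nat.mul_add_div hr, Nat.div_eq_of_lt (g (l, B')).isLt, Nat.add_zero]
    have hBB : B = B' := Fin.ext (by omega)
    subst hBB
    have : u = v := Fin.ext (by rw [hB, hB'])
    subst this
    rfl
  · rintro ⟨l, B⟩ h
    simp only [Finset.mem_filter, Finset.mem_univ, true_and] at h
    obtain ⟨hl, u, hu, huB⟩ := h
    have hr : 0 < r := (g (l, B)).pos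
    have hq : u.val / r = B.val := by
      rw [huB, Nat.mul_comm, Nat.mul_add_div hr, Nat.div_eq_of_lt (g (l, B)).isLt, Nat.add_zero]
    refine ⟨⟨u, l⟩, ?_, ?_⟩
    · simp only [blockGraph, Finset.mem_sigma, Finset.mem_inter, Finset.mem_filter,
        Finset.mem_univ, true_and]
      exact ⟨hu, ⟨B, huB⟩, hl⟩
    · simp only [Prod.mk.injEq, true_and]
      exact Fin.ext hq

/-- Exponential moment of the number of edges between `S` and `U` in a uniformly random
`blockGraph`. -/
theorem sum_half_pow_edges_le {n k r d : ℕ} (hr : 0 < r)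
    (S : Finset (Fin n)) (U : Finset (Fin k)) (hd : ∀ u : Fin n, u.val / r < d) :
    ∑ g : Fin k × Fin d → Fin r,
        (1 / 2 : ℝ) ^ (∑ u ∈ S, ((blockGraph g : BipGraph n k) u ∩ U).card) ≤
      Fintype.card (Fin k × Fin d → Fin r) *
        Real.exp (-(U.card * S.card / (2 * r))) := by
  classical
  have hr' : (0 : ℝ) < r := by exact_mod_cast hr
  obtain ⟨P, hP⟩ : ∃ P : Fin k × Fin d → Fin r → Prop, P = fun x c =>
    x.1 ∈ U ∧ ∃ u ∈ S, u.val = x.2.val * r + c.val := ⟨_, rfl⟩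
  have h1 : ∀ g : Fin k × Fin d → Fin r,
      (1 / 2 : ℝ) ^ (∑ u ∈ S, ((blockGraph g : BipGraph n k) u ∩ U).card) =
        ∏ x, (if P x (g x) then (1 / 2 : ℝ) else 1) := by
    intro g
    rw [sum_card_inter_blockGraph g S U hd, Finset.prod_ite]
    simp [hP]
  -- With `p` the fraction of positions satisfying `P x`, the mean of the factor is `1 - p / 2 ≤ exp
  -- (-p / 2)`.
  have h2 : ∀ x, ∑ c : Fin r, (if P x c then (1 / 2 : ℝ) else 1) ≤
      r * Real.exp (-((Finset.univ.filter fun c => P x c).card / (2 * r))) := by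
    intro x
    have : ∑ c : Fin r, (if P x c then (1 / 2 : ℝ) else 1) =
        r * (-((Finset.univ.filter fun c => P x c).card / (2 * r)) + 1) := by
      have h : ∀ c : Fin r, (if P x c then (1 / 2 : ℝ) else 1) =
          1 - (1 / 2) * (if P x c then 1 else 0) := by
        intro c; split_ifs <;> norm_num
      simp only [h, Finset.sum_sub_distrib, ← Finset.mul_sum, Finset.sum_boole]
      simp
      field_simp
      ring
    rw [this]
    exact mul_le_mul_of_nonneg_left (Real.add_one_le_exp _) hr'.le
  -- Each bit of `S` lies in exactly one block, at one offset, so every machine of `U` contributes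
  -- `|S|`.
  have h3 : ∑ x, ((Finset.univ.filter fun c => P x c).card) = U.card * S.card := by
    rw [← Finset.card_sigma, ← Finset.card_product]
    symm
    refine Finset.card_bij (fun y _ => ⟨(y.1, ⟨y.2.val / r, hd y.2⟩),
      ⟨y.2.val % r, Nat.mod_lt _ hr⟩⟩) ?_ ?_ ?_
    · rintro ⟨l, u⟩ h
      simp only [Finset.mem_product] at h
      simp only [hP, Finset.mem_sigma, Finset.mem_univ, Finset.mem_filter, true_and]
      exact ⟨h.1, u, h.2, (Nat.div_add_mod' _ _).symm⟩
    · rintro ⟨l, u⟩ _ ⟨l', v⟩ _ heq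
      simp only [Sigma.mk.injEq, Prod.mk.injEq, Fin.mk.injEq, heq_eq_eq] at heq
      obtain ⟨⟨rfl, hq⟩, hm⟩ := heq
      have : u = v := Fin.ext (by
        rw [← Nat.div_add_mod' u.val r, ← Nat.div_add_mod' v.val r, hq, hm])
      rw [this]
    · rintro ⟨⟨l, B⟩, c⟩ h
      simp only [hP, Finset.mem_sigma, Finset.mem_univ, Finset.mem_filter, true_and] at h
      obtain ⟨hl, u, hu, huB⟩ := h
      refine ⟨(l, u), by simp [hl, hu], ?_⟩
      have hq : u.val / r = B.val := by
        rw [huB, Nat.mul_comm, Nat.mul_add_div hr, Nat.div_eq_of_lt c.isLt, Nat.add_zero]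
      have hm : u.val % r = c.val := by
        rw [huB, Nat.mul_comm, Nat.mul_add_mod, Nat.mod_eq_of_lt c.isLt]
      simp [hq, hm]
  calc ∑ g : Fin k × Fin d → Fin r,
        (1 / 2 : ℝ) ^ (∑ u ∈ S, ((blockGraph g : BipGraph n k) u ∩ U).card)
      = ∑ g : Fin k × Fin d → Fin r, ∏ x, (if P x (g x) then (1 / 2 : ℝ) else 1) :=
        Finset.sum_congr rfl fun g _ => h1 g
    _ = ∏ x : Fin k × Fin d, ∑ c : Fin r, (if P x c then (1 / 2 : ℝ) else 1) := by
        rw [Finset.prod_univ_sum]; simp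
    _ ≤ ∏ x : Fin k × Fin d,
          (r * Real.exp (-((Finset.univ.filter fun c => P x c).card / (2 * r)))) := by
        refine Finset.prod_le_prod (fun x _ => Finset.sum_nonneg fun c _ => ?_) fun x _ => h2 x
        split_ifs <;> norm_num
    _ = _ := by
        rw [Finset.prod_mul_distrib, ← Real.exp_sum, Finset.sum_neg_distrib, ← Finset.sum_div,
          ← Nat.cast_sum, h3]
        simp

/-- A block graph in which no `m` left vertices all have fewer than `s` neighbours in a set of `a`
machines exists as soon as the union bound over all pairs of sets succeeds. -/
theorem exists_blockGraph_expands {n k r d m a : ℕ} {s : ℝ} (hr : 0 < r)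
    (hn : 0 < n) (hk : 0 < k) (hd : ∀ u : Fin n, u.val / r < d)
    (hlt : m * Real.log n + a * Real.log k + s * m * Real.log 2 < a * m / (2 * r)) :
    ∃ g : Fin k × Fin d → Fin r, ∀ (S : Finset (Fin n)) (U : Finset (Fin k)),
      S.card = m → U.card = a →
        ∃ u ∈ S, s ≤ (((blockGraph g : BipGraph n k) u ∩ U).card : ℝ) := by
  classical
  by_contra! hcon
  choose S U hS hU hlow using hcon
  have : Nonempty (Fin r) := ⟨⟨0, hr⟩⟩
  obtain ⟨N, hN⟩ : ∃ N : ℝ, N = (Fintype.card (Fin k × Fin d → Fin r) : ℕ) := ⟨_, rfl⟩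
  have hNpos : 0 < N := by rw [hN]; exact_mod_cast Fintype.card_pos
  obtain ⟨W, hW⟩ : ∃ W : (Fin k × Fin d → Fin r) → Finset (Fin n) → Finset (Fin k) → ℝ,
    W = fun g S U => (1 / 2 : ℝ) ^ (∑ u ∈ S, ((blockGraph g : BipGraph n k) u ∩ U).card) :=
    ⟨_, rfl⟩
  have hW0 : ∀ g S U, 0 ≤ W g S U := fun g S U => by simp only [hW]; positivity
  obtain ⟨I, hI⟩ : ∃ I, I = (Finset.univ : Finset (Fin n)).powersetCard m ×ˢ
    (Finset.univ : Finset (Fin k)).powersetCard a := ⟨_, rfl⟩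
  -- Under the contrary assumption each `g` has a bad pair with at most `s * m` edges, whose weight
  -- alone is at least `2 ^ (-s m)`.
  have hlower : N * Real.exp (-(s * m * Real.log 2)) ≤ ∑ g, ∑ p ∈ I, W g p.1 p.2 := by
    have : ∀ g, Real.exp (-(s * m * Real.log 2)) ≤ ∑ p ∈ I, W g p.1 p.2 := by
      intro g
      have hmem : (S g, U g) ∈ I := by simp [hI, hS, hU]
      refine le_trans ?_ (Finset.single_le_sum (f := fun p => W g p.1 p.2)
        (fun p _ => hW0 g p.1 p.2) hmem)
      have hc : ((∑ u ∈ S g, ((blockGraph g : BipGraph n k) u ∩ U g).card : ℕ) : ℝ) ≤ s * m := by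
        push_cast
        calc _ ≤ ∑ u ∈ S g, s := Finset.sum_le_sum fun u hu => (hlow g u hu).le
          _ = s * m := by simp [hS, mul_comm]
      simp only [hW]
      rw [one_div, inv_pow, ← Real.exp_log (show (0 : ℝ) < 2 by norm_num), ← Real.exp_nat_mul,
        ← Real.exp_neg, Real.exp_le_exp, Real.exp_log (by norm_num)]
      have := mul_le_mul_of_nonneg_right hc (Real.log_nonneg (show (1 : ℝ) ≤ 2 by norm_num))
      linarith
    calc _ = ∑ _g : Fin k × Fin d → Fin r, Real.exp (-(s * m * Real.log 2)) := by simp [hN]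
      _ ≤ _ := Finset.sum_le_sum fun g _ => this g
  have hupper : ∑ g, ∑ p ∈ I, W g p.1 p.2 ≤
      (n : ℝ) ^ m * (k : ℝ) ^ a * (N * Real.exp (-(a * m / (2 * r)))) := by
    rw [Finset.sum_comm]
    have h1 : ∀ p ∈ I, ∑ g, W g p.1 p.2 ≤ N * Real.exp (-(a * m / (2 * r))) := by
      rintro ⟨S, U⟩ hp
      simp only [hI, Finset.mem_product, Finset.mem_powersetCard, Finset.subset_univ,
        true_and] at hp
      have := sum_half_pow_edges_le (n := n) hr S U hd
      rw [hp.1, hp.2, ← hN] at this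
      rw [hW]
      exact this
    have h2 : (I.card : ℝ) ≤ (n : ℝ) ^ m * (k : ℝ) ^ a := by
      rw [hI, Finset.card_product, Finset.card_powersetCard, Finset.card_powersetCard]
      simp only [Finset.card_univ, Fintype.card_fin]
      exact_mod_cast Nat.mul_le_mul (Nat.choose_le_pow n m) (Nat.choose_le_pow k a)
    refine (Finset.sum_le_card_nsmul _ _ _ h1).trans ?_
    rw [nsmul_eq_mul]
    exact mul_le_mul_of_nonneg_right h2 (by positivity)
  have hfin := hlower.trans hupper
  have hnm : (n : ℝ) ^ m = Real.exp (m * Real.log n) := by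
    rw [Real.exp_nat_mul, Real.exp_log (by exact_mod_cast hn)]
  have hka : (k : ℝ) ^ a = Real.exp (a * Real.log k) := by
    rw [Real.exp_nat_mul, Real.exp_log (by exact_mod_cast hk)]
  have hrew : (n : ℝ) ^ m * (k : ℝ) ^ a * (N * Real.exp (-(a * m / (2 * r)))) =
      N * Real.exp (m * Real.log n + a * Real.log k + -(a * m / (2 * r))) := by
    rw [hnm, hka, Real.exp_add, Real.exp_add]; ring
  rw [hrew, mul_le_mul_iff_right₀ hNpos, Real.exp_le_exp] at hfin
  linarith

/-! ### Choice of parameters and existence of the expander -/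

theorem sqrt_le_glseQueryRate {n k : ℕ} {β δ : ℝ} (hn : 0 < n) (hk : 0 < k) (hδ : 0 < δ) :
    √(n / (1 - β)) ≤ glseQueryRate n k β δ := by
  have h1 : 0 ≤ Real.log n := Real.log_natCast_nonneg n
  have h2 : 0 ≤ Real.log k := Real.log_natCast_nonneg k
  have h3 : 0 < max (1 / (n : ℝ)) δ := lt_max_of_lt_right hδ
  unfold glseQueryRate
  have : 0 ≤ (n / k : ℝ) * (Real.log n / (1 - β) ^ 2)
    + 1 / max (1 / (n : ℝ)) δ * (Real.log k / (1 - β) ^ 2) := by positivity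
  linarith

theorem one_le_glseQueryRate {n k : ℕ} {β δ : ℝ} (hn : 0 < n) (hk : 0 < k) (hβ : 0 < β)
    (hβ1 : β < 1) (hδ : 0 < δ) : 1 ≤ glseQueryRate n k β δ := by
  refine le_trans ?_ (sqrt_le_glseQueryRate hn hk hδ)
  rw [Real.one_le_sqrt, one_le_div (by linarith)]
  have : (1 : ℝ) ≤ n := by exact_mod_cast hn
  linarith

/-- The complete bipartite graph expands. -/
theorem isGLSE_univ {n k : ℕ} {β δ D : ℝ} (hkn : k ≤ n)
    (hβ1 : β < 1) (hb : 1 ≤ (1 - β) * k) (hk : 0 < k) (hδ : 0 < δ) (hD : (n : ℝ) ≤ D) :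
    IsGLSE (fun _ => Finset.univ : BipGraph n k) β δ (glseThreshold n k β) D where
  degree_le l := by
    refine le_trans ?_ hD
    simp [BipGraph.nbrRight]
  expands S T hS hT := by
    have hn : (0 : ℝ) < n := by exact_mod_cast hk.trans_le hkn
    have hk' : (0 : ℝ) < k := by exact_mod_cast hk
    have hkn' : (k : ℝ) ≤ n := by exact_mod_cast hkn
    have hSpos : 0 < S.card := by
      have : (0 : ℝ) < S.card := lt_of_lt_of_le (by positivity) hS
      exact_mod_cast this
    obtain ⟨u, hu⟩ := Finset.card_pos.mp hSpos
    refine ⟨u, hu, ?_⟩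
    have hc : ((Finset.univ \ T).card : ℝ) = k - T.card := by
      rw [← Finset.compl_eq_univ_sdiff, Finset.card_compl, Nat.cast_sub (by
        simpa using Finset.card_le_univ T)]
      simp
    rw [hc]
    have hγ : 0 < 1 - β := by linarith
    -- Squaring reduces this to `β ≤ (1 - β) * n`, which follows from `1 ≤ (1 - β) * k` and `k ≤ n`.
    have hs : √(β * (1 - β) / n) ≤ 1 - β := by
      rw [Real.sqrt_le_left hγ.le, div_le_iff₀ hn]
      have : 1 ≤ (1 - β) * n := hb.trans (by gcongr)
      nlinarith
    have := mul_le_mul_of_nonneg_left hs hk'.le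
    unfold glseThreshold
    linarith

/-- The factor `5` is `4 + 1`: rounding the block length down costs a factor of at most two on top
of `1 / (2 * Q)`, and an incomplete last block adds one to the degree. -/
theorem exists_isGLSE {n k : ℕ} {β δ : ℝ} (hkn : k ≤ n) (hβ : 0 < β) (hβ1 : β < 1)
    (hb : ∃ b : ℕ, (b : ℝ) = β * k) (hk : 0 < k) (hδ : 0 < δ) :
    ∃ G : BipGraph n k, IsGLSE G β δ (glseThreshold n k β) (5 * glseQueryRate n k β δ) := by
  classical
  obtain ⟨b, hb⟩ := hb
  have hn0 : 0 < n := hk.trans_le hkn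
  have hn : (0 : ℝ) < n := by exact_mod_cast hn0
  have hn1 : (1 : ℝ) ≤ n := by exact_mod_cast hn0
  have hk' : (0 : ℝ) < k := by exact_mod_cast hk
  have hγ : 0 < 1 - β := by linarith
  have hbk : b < k := by
    have : (b : ℝ) < k := by rw [hb]; nlinarith
    exact_mod_cast this
  set a := k - b with ha
  have ha0 : 0 < a := by omega
  have haR : (a : ℝ) = (1 - β) * k := by
    rw [ha, Nat.cast_sub hbk.le, hb]; ring
  have ha0' : (0 : ℝ) < a := by exact_mod_cast ha0
  set m := ⌈δ * n⌉₊ with hm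
  have hm0 : 0 < m := Nat.ceil_pos.mpr (by positivity)
  have hm0' : (0 : ℝ) < m := by exact_mod_cast hm0
  have hln : 0 ≤ Real.log n := Real.log_natCast_nonneg n
  have hlk : 0 ≤ Real.log k := Real.log_natCast_nonneg k
  have hq1 : 1 ≤ glseQueryRate n k β δ := one_le_glseQueryRate hn0 hk hβ hβ1 hδ
  -- Multiplied by `a * m`, the three terms pay for the choice of `S`, the choice of `U`, and the
  -- threshold. The union bound needs `Q ≤ 1 / (2 * r)`.
  set Q : ℝ := Real.log n / a + Real.log k / m + √(1 / ((1 - β) * n)) with hQ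
  have hsq : 0 < √(1 / ((1 - β) * n)) := Real.sqrt_pos.mpr (by positivity)
  have hQpos : 0 < Q := by
    have : 0 ≤ Real.log n / a + Real.log k / m := by positivity
    linarith
  have hnQ : n * Q ≤ glseQueryRate n k β δ := by
    have hg2 : (1 - β) ^ 2 ≤ 1 - β := by nlinarith
    have t1 : n * (Real.log n / a) ≤ (n / k : ℝ) * (Real.log n / (1 - β) ^ 2) := by
      rw [haR]
      calc n * (Real.log n / ((1 - β) * k)) = (n / k : ℝ) * (Real.log n / (1 - β)) := by
            field_simp
        _ ≤ _ := by gcongr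
    have t2 : n * (Real.log k / m) ≤
        1 / max (1 / (n : ℝ)) δ * (Real.log k / (1 - β) ^ 2) := by
      have hmax : 0 < max (1 / (n : ℝ)) δ := lt_max_of_lt_right hδ
      have hmm : max (1 / (n : ℝ)) δ * n ≤ m := by
        rw [max_mul_of_nonneg _ _ hn.le, one_div, inv_mul_cancel₀ hn.ne']
        exact max_le (by exact_mod_cast hm0) (Nat.le_ceil _)
      have hnm : n / (m : ℝ) ≤ 1 / max (1 / (n : ℝ)) δ := by
        rw [div_le_div_iff₀ hm0' hmax]; linarith
      calc n * (Real.log k / m) = n / (m : ℝ) * (Real.log k / 1) := by ring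
        _ ≤ _ := by
          have : (1 - β) ^ 2 ≤ 1 := by nlinarith
          gcongr
    have t3 : n * √(1 / ((1 - β) * n)) = √(n / (1 - β)) := by
      rw [show (n : ℝ) / (1 - β) = n ^ 2 * (1 / ((1 - β) * n)) by field_simp,
        Real.sqrt_mul (by positivity), Real.sqrt_sq hn.le]
    unfold glseQueryRate
    rw [hQ, mul_add, mul_add, t3]
    linarith
  -- Here no block length `r ≥ 1` is admissible, but `n < 2 * (n * Q)` makes the complete graph
  -- cheap enough.
  by_cases hbig : 1 < 2 * Q
  · refine ⟨_, isGLSE_univ hkn hβ1 (by rw [← haR]; exact_mod_cast ha0) hk hδ ?_⟩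
    nlinarith
  push Not at hbig
  set r := ⌊1 / (2 * Q)⌋₊ with hr
  have hr0 : 0 < r := Nat.floor_pos.mpr ((one_le_div (by positivity)).mpr hbig)
  have hr0' : (0 : ℝ) < r := by exact_mod_cast hr0
  have hrle : (r : ℝ) * (2 * Q) ≤ 1 := by
    rw [← le_div_iff₀ (by positivity)]; exact Nat.floor_le (by positivity)
  -- Since `r ≥ 1`, the floor loses at most a factor two: `1 / (2 * Q) < r + 1 ≤ 2 * r`.
  have hrge : 1 ≤ (r : ℝ) * (4 * Q) := by
    have h := Nat.lt_floor_add_one (1 / (2 * Q))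
    rw [← hr, div_lt_iff₀ (by positivity)] at h
    have : (1 : ℝ) ≤ r := by exact_mod_cast hr0
    nlinarith
  have hs : glseThreshold n k β ≤ a * √(1 / ((1 - β) * n)) := by
    unfold glseThreshold
    rw [haR, show (1 - β) * k * √(1 / ((1 - β) * n)) =
      k * ((1 - β) * √(1 / ((1 - β) * n))) by ring]
    refine mul_le_mul_of_nonneg_left ?_ hk'.le
    rw [Real.sqrt_le_left (by positivity), mul_pow, Real.sq_sqrt (by positivity),
      show (1 - β) ^ 2 * (1 / ((1 - β) * n)) = 1 * (1 - β) / n by field_simp]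
    gcongr
  have hlt : m * Real.log n + a * Real.log k + glseThreshold n k β * m * Real.log 2 <
      a * m / (2 * r) := by
    have h1 : a * m * Q ≤ a * m / (2 * r) := by
      rw [le_div_iff₀ (by positivity)]
      nlinarith [mul_pos ha0' hm0']
    have h2 : a * m * Q =
        m * Real.log n + a * Real.log k + a * √(1 / ((1 - β) * n)) * m := by
      rw [hQ]; field_simp
    -- The strictness required by the union bound comes from `log 2 < 1`.
    have h3 : glseThreshold n k β * m * Real.log 2 < a * √(1 / ((1 - β) * n)) * m := by
      have hl2 : Real.log 2 < 1 := Real.log_two_lt_d9.trans (by norm_num)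
      have hl0 : 0 < Real.log 2 := Real.log_pos (by norm_num)
      have hp : 0 < a * √(1 / ((1 - β) * n)) * m := by positivity
      calc _ ≤ a * √(1 / ((1 - β) * n)) * m * Real.log 2 := by gcongr
        _ < _ := by nlinarith
    linarith
  clear_value r Q m a
  have hd : ∀ u : Fin n, u.val / r < n / r + 1 := fun u =>
    Nat.lt_succ_of_le (Nat.div_le_div_right u.isLt.le)
  obtain ⟨g, hg⟩ := exists_blockGraph_expands hr0 hn0 hk hd hlt
  refine ⟨blockGraph g, ⟨fun l => ?_, fun S T hS hT => ?_⟩⟩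
  · have h1 : (((blockGraph g : BipGraph n k).nbrRight l).card : ℝ) ≤ (n / r : ℕ) + 1 := by
      exact_mod_cast card_nbrRight_blockGraph_le g l
    have h2 : ((n / r : ℕ) : ℝ) ≤ n / r := Nat.cast_div_le
    have h3 : (n : ℝ) / r ≤ 4 * (n * Q) := by
      rw [div_le_iff₀ hr0', show 4 * (n * Q) * r = n * (r * (4 * Q)) by ring]
      exact le_mul_of_one_le_right hn.le hrge
    linarith
  -- Shrinking `S` to `m` bits and the complement of `T` to `a` machines only makes expansion
  -- harder.
  · obtain ⟨S', hS', hS'c⟩ := Finset.exists_subset_card_eq (hm ▸ Nat.ceil_le.mpr hS : m ≤ S.card)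
    have hTb : T.card ≤ b := by
      rw [← hb] at hT; exact_mod_cast hT
    have hTc : a ≤ (Tᶜ).card := by
      rw [Finset.card_compl, Fintype.card_fin]; omega
    obtain ⟨U, hU, hUc⟩ := Finset.exists_subset_card_eq hTc
    obtain ⟨u, hu, hsu⟩ := hg S' U hS'c hUc
    refine ⟨u, hS' hu, hsu.trans ?_⟩
    rw [Finset.sdiff_eq_inter_compl]
    exact_mod_cast Finset.card_le_card (Finset.inter_subset_inter_left hU)

/-! ### Unfolding a run of the algorithm round by round -/

open CCAAlgorithm

section Run

variable {n k : ℕ} (G : BipGraph n k) (s : ℝ) (E : Scenario n k (Nat.clog 2 n))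

/-- The state of machine `i` at the beginning of round `r`. -/
noncomputable def glseState (r : ℕ) (i : Fin k) : GLSEState n k :=
  (glseExplicitDisjunct G s).stateAt E r i

/-- The state of machine `i` after the query sub-round of round `r`. -/
noncomputable def glseMid (r : ℕ) (i : Fin k) : GLSEState n k :=
  (glseExplicitDisjunct G s).afterQuery E.input i (glseState G s E r i)

/-- The ones in the neighbourhood of machine `i`. -/
def onesFound (X : Fin n → Bool) (i : Fin k) : Finset (Fin n) :=
  (G.nbrRight i).filter fun j => X j = true

theorem decodeIndex_map_encodeIndex (o : Option (Fin n)) :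
    decodeIndex (o.map encodeIndex) = o.toFinset := by
  cases o with
  | none => rfl
  | some j =>
    have h : j.val < 2 ^ Nat.clog 2 n := j.isLt.trans_le (Nat.le_pow_clog (by norm_num) n)
    have h' : (encodeIndex j).toNat = j.val := by
      simp [encodeIndex, BitVec.toNat_ofNat, Nat.mod_eq_of_lt h]
    simp [decodeIndex, h']

theorem glseState_succ (r : ℕ) (i : Fin k) :
    glseState G s E (r + 1) i =
      if ((glseMid G s E r i).result).isSome then glseMid G s E r i
      else (glseExplicitDisjunct G s).receive i (glseMid G s E r i) (fun t =>
        (glseExplicitDisjunct G s).messageSent E r (fun t => glseMid G s E r t) t i) := rfl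

theorem glseMid_of_result_isSome {r : ℕ} {i : Fin k}
    (h : (glseState G s E r i).result.isSome) : glseMid G s E r i = glseState G s E r i := by
  unfold glseMid afterQuery
  exact if_pos h

theorem glseMid_of_result_eq_none {r : ℕ} {i : Fin k}
    (h : (glseState G s E r i).result = none) :
    glseMid G s E r i = (glseExplicitDisjunct G s).learn i (glseState G s E r i)
      (cloudAnswers E.input ((glseExplicitDisjunct G s).query i (glseState G s E r i))) := by
  unfold glseMid afterQuery
  refine if_neg ?_
  change ¬ ((glseState G s E r i).result).isSome
  simp [h]

theorem glseState_succ_of_isSome {r : ℕ} {i : Fin k}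
    (h : (glseMid G s E r i).result.isSome) :
    glseState G s E (r + 1) i = glseMid G s E r i := by
  exact (glseState_succ G s E r i).trans (if_pos h)

theorem glseState_succ_of_eq_none {r : ℕ} {i : Fin k}
    (h : (glseMid G s E r i).result = none) :
    glseState G s E (r + 1) i =
      (glseExplicitDisjunct G s).receive i (glseMid G s E r i) (fun t =>
        (glseExplicitDisjunct G s).messageSent E r (fun t => glseMid G s E r t) t i) := by
  exact (glseState_succ G s E r i).trans (if_neg (by simp [h]))

theorem glse_learn_round (l : Fin k) (st : GLSEState n k) (ans : Fin n → Option Bool) :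
    ((glseExplicitDisjunct G s).learn l st ans : GLSEState n k).round = st.round := by
  simp only [glseExplicitDisjunct]
  split_ifs
  · rfl
  · rfl
  · split
    · rfl
    · split_ifs <;> rfl

/-- A machine that has not terminated counts its rounds correctly. -/
theorem glseState_round (r : ℕ) (i : Fin k) :
    ((glseState G s E r i).result = none → (glseState G s E r i).round = r) ∧
      ((glseMid G s E r i).result = none → (glseMid G s E r i).round = r) := by
  have step : ∀ r, ((glseState G s E r i).result = none → (glseState G s E r i).round = r) →
      ((glseMid G s E r i).result = none → (glseMid G s E r i).round = r) := by
    intro r hr hmid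
    cases hst : (glseState G s E r i).result with
    | none =>
      rw [glseMid_of_result_eq_none G s E hst, glse_learn_round]
      exact hr hst
    | some o =>
      have h : (glseState G s E r i).result.isSome := by simp [hst]
      rw [glseMid_of_result_isSome G s E h] at hmid ⊢
      exact hr hmid
  induction r with
  | zero => exact ⟨fun _ => rfl, step 0 fun _ => rfl⟩
  | succ r ih =>
    have h : (glseState G s E (r + 1) i).result = none →
        (glseState G s E (r + 1) i).round = r + 1 := by
      intro h
      cases hmid : (glseMid G s E r i).result with
      | none =>
        rw [glseState_succ_of_eq_none G s E hmid]
        change (glseMid G s E r i).round + 1 = r + 1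
        rw [ih.2 hmid]
      | some o =>
        rw [glseState_succ_of_isSome G s E (by simp [hmid]), hmid] at h
        cases h
    exact ⟨h, step _ h⟩

/-! ### Message count -/

/-- No honest machine sends more than `k` messages per round, and none after round `n - 1`. -/
theorem glse_messageCount_le (R : ℕ) :
    (glseExplicitDisjunct G s).messageCount E R ≤ n * k ^ 2 := by
  classical
  have hround : ∀ r, (∑ i ∈ E.byzᶜ, (Finset.univ.filter fun j =>
      ((glseExplicitDisjunct G s).messageSent E r (fun t => glseMid G s E r t) i j).isSome).card)
        ≤ if r < n then k ^ 2 else 0 := by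
    intro r
    split_ifs with hr
    · calc _ ≤ ∑ i ∈ E.byzᶜ, k := Finset.sum_le_sum fun i _ => by
            simpa using Finset.card_le_univ (Finset.univ.filter fun j =>
              ((glseExplicitDisjunct G s).messageSent E r
                (fun t => glseMid G s E r t) i j).isSome)
        _ ≤ k * k := by
            rw [Finset.sum_const, smul_eq_mul]
            exact Nat.mul_le_mul_right _ (by simpa using Finset.card_le_univ E.byzᶜ)
        _ = k ^ 2 := (sq k).symm
    · refine (Finset.sum_eq_zero fun i hi => ?_).le
      rw [Finset.card_eq_zero, Finset.filter_eq_empty_iff]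
      intro j _
      have hi' : i ∉ E.byz := by simpa using hi
      unfold messageSent
      rw [if_neg hi']
      split_ifs with h1 h2
      · simp
      · simp
      · have hres : (glseMid G s E r i).result = none := by
          change ¬ ((glseMid G s E r i).result).isSome at h2
          simpa using h2
        have := (glseState_round G s E r i).2 hres
        have hlt : ¬ (glseMid G s E r i).round < n := by omega
        simp [glseExplicitDisjunct, hlt]
  calc (glseExplicitDisjunct G s).messageCount E R
      ≤ ∑ r ∈ Finset.range R, if r < n then k ^ 2 else 0 :=
        Finset.sum_le_sum fun r _ => hround r
    _ = ((Finset.range R).filter (· < n)).card * k ^ 2 := by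
        rw [← Finset.sum_filter, Finset.sum_const, smul_eq_mul]
    _ ≤ n * k ^ 2 := by
        refine Nat.mul_le_mul_right _ ?_
        calc _ ≤ (Finset.range n).card := Finset.card_le_card fun x hx => by
              simp at hx ⊢; exact hx.2
          _ = n := Finset.card_range n

/-! ### Phase 1: announcements -/

/-- The state of machine `i` in the announcement phase, after `r` messages were sent. -/
structure AnnounceInv (r : ℕ) (i : Fin k) (st : GLSEState n k) : Prop where
  result_eq : st.result = none
  blacklist_eq : st.blacklist = ∅
  outbox_eq : st.outbox = ((onesFound G E.input i).sort).drop r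
  heard_self : st.heard i = onesFound G E.input i
  heard_honest : ∀ t, t ≠ i → t ∉ E.byz →
    st.heard t = (((onesFound G E.input t).sort).take r).toFinset

/-- The invariant covers Byzantine `i` too: their recorded states still follow the algorithm, and
only their messages are replaced. What they announce to others is left unconstrained. -/
theorem glse_announce {r : ℕ} (hr : r < n) (i : Fin k) :
    AnnounceInv G E r i (glseMid G s E r i) ∧
      AnnounceInv G E (r + 1) i (glseState G s E (r + 1) i) := by
  -- All machines are treated at once, since what `i` hears from an honest `t` in this round is the
  -- head of the outbox of `t`.
  have step : ∀ r < n, (∀ i, AnnounceInv G E r i (glseMid G s E r i)) →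
      ∀ i, AnnounceInv G E (r + 1) i (glseState G s E (r + 1) i) := by
    intro r hr hinv i
    have hround : ∀ t, (glseMid G s E r t).round < n := fun t => by
      rw [(glseState_round G s E r t).2 (hinv t).result_eq]; exact hr
    rw [glseState_succ_of_eq_none G s E (hinv i).result_eq]
    refine ⟨(hinv i).result_eq, (hinv i).blacklist_eq, ?_, ?_, ?_⟩
    · change (glseMid G s E r i).outbox.tail = _
      rw [(hinv i).outbox_eq, List.tail_drop]
    -- No message is sent to oneself, so a machine's record of its own ones stays fixed.
    · simp only [glseExplicitDisjunct, if_pos (hround i), messageSent, if_true]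
      simp [decodeIndex, (hinv i).heard_self]
    · intro t hti htb
      simp only [glseExplicitDisjunct, if_pos (hround i), messageSent, if_neg hti, if_neg htb,
        (hinv t).result_eq, if_pos (hround t), (hinv i).heard_honest t hti htb,
        decodeIndex_map_encodeIndex, (hinv t).outbox_eq, Option.isSome_none, Bool.false_eq_true,
        if_false, List.head?_drop]
      rw [List.take_add_one, List.toFinset_append]
      cases ((onesFound G E.input t).sort)[r]? <;> simp
  suffices h : ∀ r, r < n → ∀ i, AnnounceInv G E r i (glseMid G s E r i) from
    ⟨h r hr i, step r hr (h r hr) i⟩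
  intro r
  induction r with
  | zero =>
    intro _ i
    rw [glseMid_of_result_eq_none G s E rfl]
    have hf : (Finset.univ.filter fun j => cloudAnswers E.input (G.nbrRight i) j = some true) =
        onesFound G E.input i := by
      ext j
      simp [cloudAnswers, onesFound]
    refine ⟨rfl, rfl, ?_, ?_, ?_⟩
    · change (Finset.univ.filter fun j =>
        cloudAnswers E.input (G.nbrRight i) j = some true).sort = _
      rw [hf, List.drop_zero]
    · change Function.update (fun _ => ∅ : Fin k → Finset (Fin n)) i (Finset.univ.filter fun j =>
        cloudAnswers E.input (G.nbrRight i) j = some true) i = _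
      rw [hf, Function.update_self]
    · intro t hti _
      change Function.update (fun _ => ∅ : Fin k → Finset (Fin n)) i _ t = _
      rw [Function.update_of_ne hti]
      rfl
  | succ r ih =>
    intro hr i
    have hst := step r (by omega) (ih (by omega)) i
    have hround := (glseState_round G s E (r + 1) i).1 hst.result_eq
    have : glseMid G s E (r + 1) i = glseState G s E (r + 1) i := by
      rw [glseMid_of_result_eq_none G s E hst.result_eq]
      simp only [glseExplicitDisjunct]
      rw [if_neg (by omega), if_pos (by omega)]
    rw [this]
    exact hst

theorem glse_queryCount_succ (i : Fin k) (r : ℕ) :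
    (glseExplicitDisjunct G s).queryCount E i (r + 1) =
      (glseExplicitDisjunct G s).queryCount E i r +
        ((glseExplicitDisjunct G s).queriesOf i (glseState G s E r i)).card :=
  Finset.sum_range_succ _ _

/-- In the announcement phase a machine only queries its neighbourhood. -/
theorem glse_queryCount_announce_le (i : Fin k) {r : ℕ} (hr : r ≤ n) :
    (glseExplicitDisjunct G s).queryCount E i r ≤ (G.nbrRight i).card := by
  induction r with
  | zero => simp [queryCount]
  | succ r ih =>
    rw [glse_queryCount_succ]
    cases r with
    | zero =>
      have h : (glseExplicitDisjunct G s).queriesOf i (glseState G s E 0 i) = G.nbrRight i := rfl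
      rw [h]
      simp [queryCount]
    | succ r =>
      have hst := (glse_announce G s E (show r < n by omega) i).2
      have hround := (glseState_round G s E (r + 1) i).1 hst.result_eq
      have h : (glseExplicitDisjunct G s).queriesOf i (glseState G s E (r + 1) i) = ∅ := by
        unfold queriesOf
        simp only [glseExplicitDisjunct]
        rw [if_neg (by omega), if_pos (by omega)]
        exact ite_self _
      rw [h, Finset.card_empty, Nat.add_zero]
      exact ih (by omega)

/-! ### Phase 2: verification -/

/-- The state of machine `i` after `q` unsuccessful verification rounds. -/
structure VerifyInv (q : ℕ) (i : Fin k) (st : GLSEState n k) : Prop where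
  result_eq : st.result = none
  blacklist_subset : st.blacklist ⊆ E.byz
  heard_honest : ∀ t, t ∉ E.byz → st.heard t = onesFound G E.input t
  le_card : q ≤ st.blacklist.card
  mul_le_card : q * s ≤ st.blacklist.card
  queryCount_le :
    (glseExplicitDisjunct G s).queryCount E i (n + q) ≤ (G.nbrRight i).card + q

/-- An honest machine finds at most `n` ones, so `n` rounds suffice to announce them all. -/
theorem glse_verify_zero (hn : 0 < n) {i : Fin k} :
    VerifyInv G s E 0 i (glseState G s E n i) := by
  obtain ⟨m, rfl⟩ : ∃ m, n = m + 1 := ⟨n - 1, by omega⟩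
  have h := (glse_announce G s E (show m < m + 1 by omega) i).2
  refine ⟨h.result_eq, by simp [h.blacklist_eq], fun t ht => ?_, by simp, by simp,
    glse_queryCount_announce_le G s E i le_rfl⟩
  by_cases hti : t = i
  · rw [hti, h.heard_self]
  · rw [h.heard_honest t hti ht, List.take_of_length_le, Finset.sort_toFinset]
    rw [Finset.length_sort]
    simpa using Finset.card_le_univ (onesFound G E.input t)

/-- Machine `i` has terminated by round `n + q` with a correct output, after `f` unsuccessful
verification queries. -/
def VerifyDone (q : ℕ) (i : Fin k) (st : GLSEState n k) : Prop :=
  ∃ (o : Option (Fin n)) (f : ℕ), st.result = some o ∧ ExplicitDisjunctionCorrect E.input o ∧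
    (f : ℝ) * s ≤ E.byz.card ∧
    (glseExplicitDisjunct G s).queryCount E i (n + q) ≤ (G.nbrRight i).card + f + 1

/-- One round either finds no candidate, verifies a one, or unmasks at least `s` new Byzantine
machines. Only the last case continues. -/
theorem glse_verify_succ (hn : 0 < n) (hs : 0 < s) {i : Fin k}
    (hG : (∃ j, E.input j = true) →
      ∃ u, E.input u = true ∧ s ≤ ((G u \ E.byz).card : ℝ)) {q : ℕ}
    (h : VerifyInv G s E q i (glseState G s E (n + q) i)) :
    VerifyInv G s E (q + 1) i (glseState G s E (n + (q + 1)) i) ∨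
      VerifyDone G s E (q + 1) i (glseState G s E (n + (q + 1)) i) := by
  classical
  set st := glseState G s E (n + q) i with hst
  have hround : st.round = n + q := (glseState_round G s E (n + q) i).1 h.result_eq
  have hmid := glseMid_of_result_eq_none G s E (r := n + q) (i := i) h.result_eq
  rw [← hst] at hmid
  have hqc := glse_queryCount_succ G s E i (n + q)
  rw [← hst, show n + q + 1 = n + (q + 1) from rfl] at hqc
  have hqs : (q : ℝ) * s ≤ E.byz.card :=
    h.mul_le_card.trans (by exact_mod_cast Finset.card_le_card h.blacklist_subset)
  have hqle := h.queryCount_le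
  cases hc : st.candidate s with
  | none =>
    right
    have hq0 : (glseExplicitDisjunct G s).query i st = ∅ := by
      simp only [glseExplicitDisjunct]
      rw [if_neg (by omega), if_neg (by omega), hc]
    have hm : glseMid G s E (n + q) i = { st with result := some none } := by
      rw [hmid]
      simp only [glseExplicitDisjunct]
      rw [if_neg (by omega), if_neg (by omega), hc]
    have hq0' : ((glseExplicitDisjunct G s).queriesOf i st).card = 0 := by
      unfold queriesOf
      rw [hq0, ite_self, Finset.card_empty]
    refine ⟨none, q, ?_, ?_, hqs, by omega⟩
    · rw [← Nat.add_assoc, glseState_succ_of_isSome G s E (by rw [hm]; rfl), hm]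
    · intro j
      by_contra hj
      -- The honest neighbours of `u` have all announced it and none is blacklisted, so `u` would
      -- have been a candidate.
      obtain ⟨u, hu, hsu⟩ := hG ⟨j, by simpa using hj⟩
      unfold GLSEState.candidate at hc
      rw [List.find?_eq_none] at hc
      refine hc u (List.mem_finRange u) (decide_eq_true (hsu.trans ?_))
      have : G u \ E.byz ⊆ Finset.univ.filter fun t => t ∉ st.blacklist ∧ u ∈ st.heard t := by
        intro t ht
        rw [Finset.mem_sdiff] at ht
        simp only [Finset.mem_filter, Finset.mem_univ, true_and]
        refine ⟨fun hb => ht.2 (h.blacklist_subset hb), ?_⟩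
        rw [h.heard_honest t ht.2]
        simp [onesFound, BipGraph.nbrRight, ht.1, hu]
      exact_mod_cast Finset.card_le_card this
  | some j =>
    have hq0 : (glseExplicitDisjunct G s).query i st = {j} := by
      simp only [glseExplicitDisjunct]
      rw [if_neg (by omega), if_neg (by omega), hc]
    have hq0' : ((glseExplicitDisjunct G s).queriesOf i st).card ≤ 1 := by
      unfold queriesOf
      rw [hq0]
      split_ifs <;> simp
    have hm : glseMid G s E (n + q) i =
        if E.input j = true then { st with result := some (some j) }
        else { st with
          blacklist := st.blacklist ∪ Finset.univ.filter fun t => j ∈ st.heard t } := by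
      rw [hmid, hq0]
      simp only [glseExplicitDisjunct]
      rw [if_neg (by omega), if_neg (by omega), hc]
      simp [cloudAnswers]
    by_cases hj : E.input j = true
    · rw [if_pos hj] at hm
      right
      refine ⟨some j, q, ?_, hj, hqs, by omega⟩
      rw [← Nat.add_assoc, glseState_succ_of_isSome G s E (by rw [hm]; rfl), hm]
    · rw [if_neg hj] at hm
      left
      have hres : (glseMid G s E (n + q) i).result = none := by rw [hm]; exact h.result_eq
      have hrd : ¬ (glseMid G s E (n + q) i).round < n := by
        rw [(glseState_round G s E (n + q) i).2 hres]; omega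
      rw [← Nat.add_assoc, glseState_succ_of_eq_none G s E hres]
      have hsj := List.find?_some hc
      simp only [decide_eq_true_eq] at hsj
      -- The candidate's supporters are counted outside the blacklist, so all of them enlarge it.
      have hcard : (Finset.univ.filter fun t => t ∉ st.blacklist ∧ j ∈ st.heard t).card +
          st.blacklist.card ≤
            (st.blacklist ∪ Finset.univ.filter fun t => j ∈ st.heard t).card := by
        rw [← Finset.card_union_of_disjoint]
        · refine Finset.card_le_card fun t ht => ?_
          simp only [Finset.mem_union, Finset.mem_filter, Finset.mem_univ, true_and] at ht ⊢
          tauto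
        · rw [Finset.disjoint_left]
          intro t ht
          simp only [Finset.mem_filter] at ht
          exact ht.2.1
      -- The threshold may be below one; positivity still forces one new blacklisted machine per
      -- failure, which bounds the number of rounds.
      have hpos : 0 < (Finset.univ.filter fun t => t ∉ st.blacklist ∧ j ∈ st.heard t).card := by
        have := hs.trans_le hsj
        exact_mod_cast this
      have hbl : ((glseExplicitDisjunct G s).receive i (glseMid G s E (n + q) i) (fun t =>
          (glseExplicitDisjunct G s).messageSent E (n + q)
            (fun t => glseMid G s E (n + q) t) t i) : GLSEState n k).blacklist =
          st.blacklist ∪ Finset.univ.filter fun t => j ∈ st.heard t := by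
        change (glseMid G s E (n + q) i).blacklist = _
        rw [hm]
      have hcardR : (((Finset.univ.filter fun t =>
          t ∉ st.blacklist ∧ j ∈ st.heard t).card : ℕ) : ℝ) + st.blacklist.card ≤
            (st.blacklist ∪ Finset.univ.filter fun t => j ∈ st.heard t).card := by
        exact_mod_cast hcard
      refine ⟨hres, ?_, fun t ht => ?_, ?_, ?_, by omega⟩
      · rw [hbl]
        -- An honest machine announces only ones, so every announcer of the zero at `j` is
        -- Byzantine.
        refine Finset.union_subset h.blacklist_subset fun t ht => ?_
        by_contra htb
        simp only [Finset.mem_filter, Finset.mem_univ, true_and, h.heard_honest t htb,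
          onesFound] at ht
        exact hj ht.2
      · simp only [glseExplicitDisjunct]
        rw [if_neg hrd, hm]
        exact h.heard_honest t ht
      · rw [hbl]
        have := h.le_card
        omega
      · rw [hbl]
        have := h.mul_le_card
        push_cast
        linarith

theorem glse_verify (hn : 0 < n) (hs : 0 < s) {i : Fin k}
    (hG : (∃ j, E.input j = true) →
      ∃ u, E.input u = true ∧ s ≤ ((G u \ E.byz).card : ℝ)) (q : ℕ) :
    VerifyInv G s E q i (glseState G s E (n + q) i) ∨
      VerifyDone G s E q i (glseState G s E (n + q) i) := by
  induction q with
  | zero => exact Or.inl (glse_verify_zero G s E hn)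
  | succ q ih =>
    rcases ih with h | ⟨o, f, ho, hcorr, hf, hqc⟩
    · exact glse_verify_succ G s E hn hs hG h
    · right
      have hsome : (glseState G s E (n + q) i).result.isSome := by simp [ho]
      have hmid := glseMid_of_result_isSome G s E hsome
      have hst : glseState G s E (n + (q + 1)) i = glseState G s E (n + q) i := by
        rw [← Nat.add_assoc, glseState_succ_of_isSome G s E (by rw [hmid]; exact hsome), hmid]
      refine ⟨o, f, by rw [hst, ho], hcorr, hf, ?_⟩
      have hz : (glseExplicitDisjunct G s).queriesOf i (glseState G s E (n + q) i) = ∅ :=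
        if_pos hsome
      rw [← Nat.add_assoc, glse_queryCount_succ, hz]
      simpa using hqc

/-- All machines have terminated with a correct output after `n + k + 1` rounds. -/
theorem glse_verifyDone (hn : 0 < n) (hs : 0 < s) {i : Fin k}
    (hG : (∃ j, E.input j = true) →
      ∃ u, E.input u = true ∧ s ≤ ((G u \ E.byz).card : ℝ)) :
    VerifyDone G s E (k + 1) i (glseState G s E (n + (k + 1)) i) := by
  -- Still running would mean a blacklist of at least `k + 1` out of `k` machines.
  refine (glse_verify G s E hn hs hG (k + 1)).resolve_left fun h => ?_
  have h1 := h.le_card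
  have h2 := Finset.card_le_univ (glseState G s E (n + (k + 1)) i).blacklist
  rw [Fintype.card_fin] at h2
  omega

theorem glse_queryCount_le (hn : 0 < n) (hs : 0 < s) {i : Fin k}
    (hG : (∃ j, E.input j = true) →
      ∃ u, E.input u = true ∧ s ≤ ((G u \ E.byz).card : ℝ)) (R : ℕ) :
    ∃ f : ℕ, (f : ℝ) * s ≤ E.byz.card ∧
      (glseExplicitDisjunct G s).queryCount E i R ≤ (G.nbrRight i).card + f + 1 := by
  -- The verification invariants describe only rounds `n + q`, so an arbitrary `R` is padded to `n +
  -- R`.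
  have hmono : (glseExplicitDisjunct G s).queryCount E i R ≤
      (glseExplicitDisjunct G s).queryCount E i (n + R) :=
    Finset.sum_le_sum_of_subset (Finset.range_mono (Nat.le_add_left R n))
  rcases glse_verify G s E hn hs hG R (i := i) with h | ⟨o, f, -, -, hf, hqc⟩
  · refine ⟨R, h.mul_le_card.trans ?_, (hmono.trans h.queryCount_le).trans (Nat.le_succ _)⟩
    exact_mod_cast Finset.card_le_card h.blacklist_subset
  · exact ⟨f, hf, hmono.trans hqc⟩

end Run

/-! ### Bounding the failures and assembling the theorem -/

theorem glseThreshold_pos {n k : ℕ} {β : ℝ} (hn : 0 < n) (hk : 0 < k) (hβ : 0 < β)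
    (hβ1 : β < 1) : 0 < glseThreshold n k β := by
  have hn' : (0 : ℝ) < n := by exact_mod_cast hn
  have hk' : (0 : ℝ) < k := by exact_mod_cast hk
  have hγ : 0 < 1 - β := by linarith
  exact mul_pos hk' (Real.sqrt_pos.mpr (by positivity))

/-- At most `√(n / γ)` disjoint sets of `s` machines fit into a set of `β k` machines. -/
theorem le_sqrt_of_mul_glseThreshold_le {n k : ℕ} {β f : ℝ} (hn : 0 < n) (hk : 0 < k)
    (hβ : 0 < β) (hβ1 : β < 1) (hf : f * glseThreshold n k β ≤ β * k) :
    f ≤ √(n / (1 - β)) := by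
  have hn' : (0 : ℝ) < n := by exact_mod_cast hn
  have hk' : (0 : ℝ) < k := by exact_mod_cast hk
  have hγ : 0 < 1 - β := by linarith
  refine le_of_mul_le_mul_right (hf.trans ?_) (glseThreshold_pos hn hk hβ hβ1)
  -- Thus `√(n / γ)` failures would already use up `√β * k ≥ β * k` machines.
  have h : √(n / (1 - β)) * glseThreshold n k β = √β * k := by
    unfold glseThreshold
    rw [mul_left_comm, ← Real.sqrt_mul (by positivity),
      show n / (1 - β) * (β * (1 - β) / n) = β by field_simp]
    ring
  rw [h]
  have : β ≤ √β := Real.le_sqrt_of_sq_le (by nlinarith)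
  gcongr

/-- A GLSE has a left vertex holding a one with enough honest neighbours, unless the input is
zero. -/
theorem IsGLSE.exists_one_of_mem_scenarios {n k w : ℕ} {G : BipGraph n k} {β δ s D : ℝ}
    (hG : IsGLSE G β δ s D) {E : Scenario n k w}
    (hE : E ∈ explicitDisjunctionScenarios n k w β δ) (h : ∃ j, E.input j = true) :
    ∃ u, E.input u = true ∧ s ≤ ((G u \ E.byz).card : ℝ) := by
  obtain ⟨j, hj⟩ := h
  obtain ⟨hbyz, hzero | hmany⟩ := hE
  · rw [onesCount, Finset.card_eq_zero, Finset.filter_eq_empty_iff] at hzero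
    exact absurd hj (hzero (Finset.mem_univ j))
  · obtain ⟨u, hu, hsu⟩ := hG.expands _ E.byz hmany hbyz
    exact ⟨u, by simpa using hu, hsu⟩

theorem mainTheorem10 :
    ∃ C₀ C : ℝ, 0 < C₀ ∧ 0 < C ∧
      ∀ (n k : ℕ) (β δ : ℝ), k ≤ n → 0 < β → β < 1 → (∃ b : ℕ, (b : ℝ) = β * k) → 0 < k →
        0 < δ → δ ≤ 1 →
        (∃ G : BipGraph n k, IsGLSE G β δ (glseThreshold n k β) (C₀ * glseQueryRate n k β δ)) ∧
        ∀ G : BipGraph n k,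
          IsGLSE G β δ (glseThreshold n k β) (C₀ * glseQueryRate n k β δ) →
          (glseExplicitDisjunct G (glseThreshold n k β)).Solves
              (explicitDisjunctionScenarios n k (Nat.clog 2 n) β δ) ExplicitDisjunctionCorrect ∧
          (glseExplicitDisjunct G (glseThreshold n k β)).QueryComplexityLE
              (explicitDisjunctionScenarios n k (Nat.clog 2 n) β δ)
              (C * glseQueryRate n k β δ) ∧
          (glseExplicitDisjunct G (glseThreshold n k β)).RoundComplexityLE
              (explicitDisjunctionScenarios n k (Nat.clog 2 n) β δ) (C * n) ∧
          (glseExplicitDisjunct G (glseThreshold n k β)).MessageComplexityLE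
              (explicitDisjunctionScenarios n k (Nat.clog 2 n) β δ) (C * (n * (k : ℝ) ^ 2)) := by

  -- The `7` is `5` for the degree, `1` for the failures and `1` for the final query; it also covers
  -- `n + k + 1 ≤ 3 * n` rounds.
  refine ⟨5, 7, by norm_num, by norm_num, ?_⟩
  intro n k β δ hkn hβ hβ1 hb hk hδ _
  refine ⟨exists_isGLSE hkn hβ hβ1 hb hk hδ, fun G hG => ?_⟩
  have hn : 0 < n := hk.trans_le hkn
  have hs := glseThreshold_pos hn hk hβ hβ1
  refine ⟨fun E hE i _ => ?_, fun E hE i _ R => ?_, fun E hE => ?_, fun E _ R => ?_⟩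
  · obtain ⟨o, -, ho, hcorr, -⟩ := glse_verifyDone G _ E hn hs (i := i)
      (hG.exists_one_of_mem_scenarios hE)
    exact ⟨n + (k + 1), o, ho, hcorr⟩
  · obtain ⟨f, hf, hq⟩ := glse_queryCount_le G _ E hn hs (i := i)
      (hG.exists_one_of_mem_scenarios hE) R
    have h1 := le_sqrt_of_mul_glseThreshold_le hn hk hβ hβ1 (hf.trans hE.1)
    have h2 := sqrt_le_glseQueryRate (β := β) hn hk hδ
    have h3 := one_le_glseQueryRate hn hk hβ hβ1 hδ
    have h4 := hG.degree_le i
    have hq' : (((glseExplicitDisjunct G (glseThreshold n k β)).queryCount E i R : ℕ) : ℝ) ≤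
        (G.nbrRight i).card + f + 1 := by exact_mod_cast hq
    linarith
  · refine ⟨n + (k + 1), ?_, fun i _ => ?_⟩
    · have h1 : (1 : ℝ) ≤ n := by exact_mod_cast hn
      have h2 : (k : ℝ) ≤ n := by exact_mod_cast hkn
      push_cast
      linarith
    · obtain ⟨o, -, ho, -⟩ := glse_verifyDone G _ E hn hs (i := i)
        (hG.exists_one_of_mem_scenarios hE)
      exact Option.isSome_iff_exists.mpr ⟨o, ho⟩
  · have h : (((glseExplicitDisjunct G (glseThreshold n k β)).messageCount E R : ℕ) : ℝ) ≤
        n * (k : ℝ) ^ 2 := by exact_mod_cast glse_messageCount_le G _ E R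
    have : (0 : ℝ) ≤ n * (k : ℝ) ^ 2 := by positivity
    linarith
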